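/- Let $T=\mathbb{N}$ or $T=\mathbb{Z}$, let $\mathcal{X},\mathcal{Y}\subseteq\mathbb{R}$, let $g:\mathcal{X}\to\mathcal{Y}$ be measurable, and let $\mathbf{X}=(X_n)_{n\in T}$ be a stationary Markov process with values in $\mathcal{X}$. Here a real-valued process $(Z_n)_{n\in T}$ is called Markov if for all times $n_1<\dots<n_i<n$ ($i\ge 1$) and all $a\in\mathbb{R}$, almost surely $\Pr(Z_n\le a\mid Z_{n_1},\dots,Z_{n_i})=\Pr(Z_n\le a\mid Z_{n_i})$. Put $Y_n:=g(X_n)$. Assume that $(Y_2,X_1)$ has a joint density $f_{Y_2,X_1}$, that $Y_2$ has a conditional density $f_{Y_2|X_1}$ given $X_1$, and that $Y_2$ has a conditional density $f_{Y_2|Y_1}$ given $Y_1$, all with respect to Lebesgue measure, and fix versions of these densities. If for all $y_1,y_2\in\mathcal{Y}$ and all $x\in g^{-1}[y_1]$ $$f_{Y_2,X_1}(y_2,x)>0\ \Longrightarrow\ f_{Y_2|X_1}(y_2|x)=f_{Y_2|Y_1}(y_2|y_1),$$ then $\mathbf{X}$ is lumpable with respect to $g$, i.e., the process $\mathbf{Y}=(Y_n)_{n\in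 T}$ is Markov. -/

import Mathlib

open MeasureTheory ProbabilityTheory
open scoped ENNReal

/-- The process `X` is (strictly) stationary: the law of the whole process is invariant under the
shift of time by one step. The time set `ι` is meant to be `ℕ` or `ℤ`. -/
def IsStationaryProcess {ι Ω E : Type*} [LinearOrder ι] [SuccOrder ι] [MeasurableSpace Ω]
    [MeasurableSpace E] (X : ι → Ω → E) (μ : Measure Ω) : Prop :=
  μ.map (fun ω (n : ι) => X (Order.succ n) ω) = μ.map (fun ω (n : ι) => X n ω)

/-- The process `X` with alphabet `S ⊆ ℝ` is a Markov process: for all times `n₀ < ⋯ < nₖ < m` and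
all real `a`, almost surely
`P(X_m ≤ a | X_{n₀}, …, X_{nₖ}) = P(X_m ≤ a | X_{nₖ})`. -/
def IsMarkovProcess {ι Ω : Type*} [LinearOrder ι] [MeasurableSpace Ω] {S : Set ℝ}
    (X : ι → Ω → S) (μ : Measure Ω) : Prop :=
  ∀ (k : ℕ) (n : Fin (k + 1) → ι) (m : ι) (a : ℝ), StrictMono n → n (Fin.last k) < m →
    μ⟦{ω | (X m ω : ℝ) ≤ a} |
        MeasurableSpace.comap (fun ω (j : Fin (k + 1)) => X (n j) ω) inferInstance⟧
      =ᵐ[μ]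
    μ⟦{ω | (X m ω : ℝ) ≤ a} | MeasurableSpace.comap (X (n (Fin.last k))) inferInstance⟧

/-- `X` is lumpable with respect to `g`: the process `Y n = g (X n)` is Markov. -/
def IsLumpable {ι Ω : Type*} [LinearOrder ι] [MeasurableSpace Ω] {S T : Set ℝ}
    (X : ι → Ω → S) (g : S → T) (μ : Measure Ω) : Prop :=
  IsMarkovProcess (fun n ω => g (X n ω)) μ

/-- `f` is (a version of) the joint probability density `f_{V,U}` of `(V, U)` with respect to
Lebesgue measure on the plane; `f v u` is its value at `(v, u)`. -/
def IsJointDensity {Ω : Type*} [MeasurableSpace Ω] (f : ℝ → ℝ → ℝ≥0∞) (V U : Ω → ℝ)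
    (μ : Measure Ω) : Prop :=
  Measurable (Function.uncurry f) ∧
    μ.map (fun ω => (V ω, U ω)) = (volume : Measure (ℝ × ℝ)).withDensity (Function.uncurry f)

/-- `f` is (a version of) the conditional probability density `f_{V|U}` of `V` given `U` with
respect to Lebesgue measure; `f v u` is `f_{V|U}(v|u)`. -/
def IsCondDensity {Ω : Type*} [MeasurableSpace Ω] (f : ℝ → ℝ → ℝ≥0∞) (V U : Ω → ℝ)
    (μ : Measure Ω) : Prop :=
  Measurable (Function.uncurry f) ∧
    ∀ A B : Set ℝ, MeasurableSet A → MeasurableSet B →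
      μ (V ⁻¹' A ∩ U ⁻¹' B) = ∫⁻ u in B, (∫⁻ v in A, f v u) ∂(μ.map U)

/-!
Write `f` for the conditional density of `Y₂` given `Y₁` and `Tφ(y) = ∫ φ(v) f(v|y) dv` for the
operator it defines on nonnegative functions (`densityOp`).

The joint density of `(Y₂, X₁)` is almost surely positive at `(Y₂, X₁)`, so the hypothesis gives
`f_{Y₂|X₁}(Y₂|X₁) = f(Y₂|g(X₁))` almost surely. As the law of `(Y₂, X₁)` has density `f_{Y₂|X₁}`
with respect to `Lebesgue ⊗ law(X₁)`, this means that `f_{Y₂|X₁}(v|u) ≤ f(v|g(u))` almost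
everywhere for that product measure. Both sides have total mass one, so they agree almost
everywhere: given `X₁`, the variable `Y₂` has a density that depends on `g(X₁)` only
(`map_eq_withDensity_of_ae_eq`). By stationarity the same holds at all times.

The Markov property of `X` extends from half-lines to all nonnegative functions of the future state
(`IsMarkovProcess.setLIntegral_eq`), so that `E[φ(Y_{l+1}) | X_{n₀}, …, X_l] = Tφ(Y_l)`, and, by
adding intermediate times to the past one at a time, `E[φ(Y_{l+i}) | X_{n₀}, …, X_l] = Tⁱφ(Y_l)`
(`IsMarkovProcess.setLIntegral_iterate_succ_eq_densityOp`). The right-hand side is a function of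
`Y_l`, hence is also the conditional expectation given `Y_{n₀}, …, Y_l` and the one given `Y_l`.
Conditional expectations are handled through integrals of `ℝ≥0∞`-valued functions over past events,
which avoids integrability conditions on `Tⁱφ`.
-/

/-! ### Conditional densities -/

/-- The operator `φ ↦ (y ↦ ∫ φ(v) f(v|y) dv)` on nonnegative functions attached to the
conditional density `f`. -/
noncomputable def densityOp (f : ℝ → ℝ → ℝ≥0∞) (φ : ℝ → ℝ≥0∞) (y : ℝ) : ℝ≥0∞ :=
  ∫⁻ v, φ v * f v y

lemma measurable_densityOp {f : ℝ → ℝ → ℝ≥0∞} (hf : Measurable (Function.uncurry f))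
    {φ : ℝ → ℝ≥0∞} (hφ : Measurable φ) : Measurable (densityOp f φ) :=
  ((hφ.comp measurable_fst).mul hf).lintegral_prod_left'

lemma measurable_densityOp_iterate {f : ℝ → ℝ → ℝ≥0∞} (hf : Measurable (Function.uncurry f))
    {φ : ℝ → ℝ≥0∞} (hφ : Measurable φ) (j : ℕ) : Measurable ((densityOp f)^[j] φ) := by
  induction j with
  | zero => exact hφ
  | succ j ih =>
    rw [Function.iterate_succ_apply']
    exact measurable_densityOp hf ih

lemma IsCondDensity.map_eq_withDensity {Ω : Type*} [MeasurableSpace Ω] {μ : Measure Ω}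
    [IsProbabilityMeasure μ] {f : ℝ → ℝ → ℝ≥0∞} {V U : Ω → ℝ} (hV : Measurable V)
    (hU : Measurable U) (hf : IsCondDensity f V U μ) :
    μ.map (fun ω => (V ω, U ω)) =
      ((volume : Measure ℝ).prod (μ.map U)).withDensity (Function.uncurry f) := by
  have := Measure.isProbabilityMeasure_map (μ := μ) hU.aemeasurable
  have := Measure.isProbabilityMeasure_map (μ := μ) (hV.prodMk hU).aemeasurable
  refine Measure.ext_prod fun {A B} hA hB => ?_
  rw [Measure.map_apply (hV.prodMk hU) (hA.prod hB), withDensity_apply _ (hA.prod hB),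
    setLIntegral_prod_symm _ hf.1.aemeasurable]
  exact hf.2 A B hA hB

/-- If the conditional densities of `V` given `U` and of `V` given `G(U)` agree almost surely at
`(V, U)`, then `V` has, given `U`, the conditional density that depends on `U` through `G(U)`
only. -/
lemma map_eq_withDensity_of_ae_eq {Ω : Type*} [MeasurableSpace Ω] {μ : Measure Ω}
    [IsProbabilityMeasure μ] {q f : ℝ → ℝ → ℝ≥0∞} {V U : Ω → ℝ} {G : ℝ → ℝ}
    (hV : Measurable V) (hU : Measurable U) (hG : Measurable G)
    (hq : IsCondDensity q V U μ) (hf : IsCondDensity f V (fun ω => G (U ω)) μ)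
    (h : ∀ᵐ w ∂μ.map (fun ω => (V ω, U ω)), q w.1 w.2 = f w.1 (G w.2)) :
    μ.map (fun ω => (V ω, U ω)) =
      ((volume : Measure ℝ).prod (μ.map U)).withDensity (fun w => f w.1 (G w.2)) := by
  have := Measure.isProbabilityMeasure_map (μ := μ) hU.aemeasurable
  have hr : Measurable (fun w : ℝ × ℝ => f w.1 (G w.2)) :=
    hf.1.comp (measurable_fst.prodMk (hG.comp measurable_snd))
  have hlaw := hq.map_eq_withDensity hV hU
  have hmass : ∫⁻ w, Function.uncurry q w ∂((volume : Measure ℝ).prod (μ.map U)) = 1 := by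
    rw [← setLIntegral_univ, ← withDensity_apply _ MeasurableSet.univ, ← hlaw,
      Measure.map_apply (hV.prodMk hU) MeasurableSet.univ]
    simp
  have hmass' : ∫⁻ w, f w.1 (G w.2) ∂((volume : Measure ℝ).prod (μ.map U)) = 1 := by
    have h1 := hf.2 Set.univ Set.univ MeasurableSet.univ MeasurableSet.univ
    have hm : Measurable (fun y => ∫⁻ v, f v y) := hf.1.lintegral_prod_left'
    simp only [Set.preimage_univ, Set.inter_self, measure_univ, Measure.restrict_univ] at h1
    rw [lintegral_map hm (show Measurable fun ω => G (U ω) from hG.comp hU)] at h1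
    rw [lintegral_prod_symm _ hr.aemeasurable, lintegral_map hr.lintegral_prod_left' hU, ← h1]
  rw [hlaw] at h ⊢
  rw [ae_withDensity_iff hq.1] at h
  have hle : Function.uncurry q ≤ᵐ[(volume : Measure ℝ).prod (μ.map U)]
      fun w => f w.1 (G w.2) := by
    filter_upwards [h] with w hw
    by_cases h0 : Function.uncurry q w = 0
    · simp [h0]
    · exact (hw h0).le
  -- Both functions have total mass one, so the inequality is an equality.
  exact withDensity_congr_ae (ae_eq_of_ae_le_of_lintegral_le hle (by simp [hmass]) hr.aemeasurable
    (by rw [hmass, hmass']))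

/-- If `(v, u) ↦ f(v|G(u))` is a conditional density of `V` given `U`, then the conditional
expectation of `φ(V)` given `U` is `densityOp f φ (G(U))`. -/
lemma setLIntegral_eq_densityOp {Ω : Type*} [MeasurableSpace Ω] {μ : Measure Ω}
    [IsProbabilityMeasure μ] {f : ℝ → ℝ → ℝ≥0∞} {V U : Ω → ℝ} {G : ℝ → ℝ}
    (hV : Measurable V) (hU : Measurable U) (hG : Measurable G)
    (hf : Measurable (Function.uncurry f))
    (h : μ.map (fun ω => (V ω, U ω)) =
      ((volume : Measure ℝ).prod (μ.map U)).withDensity (fun w => f w.1 (G w.2)))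
    {φ : ℝ → ℝ≥0∞} (hφ : Measurable φ) {B : Set ℝ} (hB : MeasurableSet B) :
    ∫⁻ ω in U ⁻¹' B, φ (V ω) ∂μ = ∫⁻ ω in U ⁻¹' B, densityOp f φ (G (U ω)) ∂μ := by
  have := Measure.isProbabilityMeasure_map (μ := μ) hU.aemeasurable
  have hr : Measurable (fun w : ℝ × ℝ => f w.1 (G w.2)) :=
    hf.comp (measurable_fst.prodMk (hG.comp measurable_snd))
  have hφ' : Measurable (fun w : ℝ × ℝ => φ w.1) := hφ.comp measurable_fst
  have hC : MeasurableSet (Set.univ ×ˢ B : Set (ℝ × ℝ)) := MeasurableSet.univ.prod hB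
  calc ∫⁻ ω in U ⁻¹' B, φ (V ω) ∂μ
      = ∫⁻ w in Set.univ ×ˢ B, φ w.1 ∂μ.map (fun ω => (V ω, U ω)) := by
        rw [setLIntegral_map hC hφ' (hV.prodMk hU)]
        simp [Set.preimage, Set.mem_prod]
    _ = ∫⁻ w in Set.univ ×ˢ B, φ w.1 * f w.1 (G w.2) ∂(volume.prod (μ.map U)) := by
        rw [h, setLIntegral_withDensity_eq_setLIntegral_mul _ hr hφ' hC]
        simp [mul_comm]
    _ = ∫⁻ u in B, densityOp f φ (G u) ∂μ.map U := by
        rw [setLIntegral_prod_symm (fun w => φ w.1 * f w.1 (G w.2)) (hφ'.mul hr).aemeasurable]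
        simp [densityOp]
    _ = ∫⁻ ω in U ⁻¹' B, densityOp f φ (G (U ω)) ∂μ :=
        setLIntegral_map hB ((measurable_densityOp hf hφ).comp hG) hU

/-! ### Stationarity -/

lemma IsStationaryProcess.map_succ_pair {ι Ω E : Type*} [LinearOrder ι] [SuccOrder ι]
    [IsSuccArchimedean ι] [MeasurableSpace Ω] [MeasurableSpace E] {X : ι → Ω → E} {μ : Measure Ω}
    (h : IsStationaryProcess X μ) (hX : ∀ n, Measurable (X n)) (s t : ι) :
    μ.map (fun ω => (X (Order.succ s) ω, X s ω)) =
      μ.map (fun ω => (X (Order.succ t) ω, X t ω)) := by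
  have step (n : ι) : μ.map (fun ω => (X (Order.succ (Order.succ n)) ω, X (Order.succ n) ω)) =
      μ.map (fun ω => (X (Order.succ n) ω, X n ω)) := by
    have hp : Measurable (fun x : ι → E => (x (Order.succ n), x n)) := by fun_prop
    have h' := congrArg (Measure.map (fun x : ι → E => (x (Order.succ n), x n))) h
    rwa [Measure.map_map hp (measurable_pi_lambda _ fun n => hX _),
      Measure.map_map hp (measurable_pi_lambda _ fun n => hX _)] at h'
  have up (a b : ι) (hab : a ≤ b) : μ.map (fun ω => (X (Order.succ b) ω, X b ω)) =
      μ.map (fun ω => (X (Order.succ a) ω, X a ω)) := by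
    induction hab using Succ.rec with
    | rfl => rfl
    | succ _ _ ih => rw [step, ih]
  rcases le_total s t with hst | hst
  · exact (up s t hst).symm
  · exact up t s hst

/-! ### Conditioning on the past of a Markov process -/

/-- The Markov property, stated for half-lines, passes to all nonnegative functions of the future
state: their integral over a past event is that of the regular conditional distribution given the
present state. -/
lemma IsMarkovProcess.setLIntegral_eq {ι Ω : Type*} [LinearOrder ι] [MeasurableSpace Ω]
    {S : Set ℝ} {X : ι → Ω → S} {μ : Measure Ω} [IsProbabilityMeasure μ]
    (hX : ∀ n, Measurable (X n)) (h : IsMarkovProcess X μ) {k : ℕ} {n : Fin (k + 1) → ι}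
    (hn : StrictMono n) {m : ι} (hm : n (Fin.last k) < m) {s : Set Ω}
    (hs : MeasurableSet[MeasurableSpace.comap (fun ω (j : Fin (k + 1)) => X (n j) ω)
      inferInstance] s) {φ : ℝ → ℝ≥0∞} (hφ : Measurable φ) :
    ∫⁻ ω in s, φ (X m ω) ∂μ = ∫⁻ ω in s, (∫⁻ z, φ z
      ∂(condDistrib (fun ω => (X m ω : ℝ)) (X (n (Fin.last k))) μ (X (n (Fin.last k)) ω))) ∂μ := by
  set κ := condDistrib (fun ω => (X m ω : ℝ)) (X (n (Fin.last k))) μ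
  have hXm : Measurable (fun ω => (X m ω : ℝ)) := (hX m).subtype_val
  have hA (a : ℝ) : MeasurableSet {ω | (X m ω : ℝ) ≤ a} := hXm measurableSet_Iic
  have hpast : MeasurableSpace.comap (fun ω (j : Fin (k + 1)) => X (n j) ω) inferInstance ≤ ‹_› :=
    (measurable_pi_lambda _ fun j => hX (n j)).comap_le
  have hs' : MeasurableSet s := hpast s hs
  have key : (μ.restrict s).map (fun ω => (X m ω : ℝ)) =
      ((μ.restrict s).map (X (n (Fin.last k)))).bind κ := by
    refine Measure.ext_of_Iic _ _ fun a => ?_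
    rw [Measure.bind_apply measurableSet_Iic (Kernel.aemeasurable _),
      lintegral_map (Kernel.measurable_coe _ measurableSet_Iic) (hX _),
      Measure.map_apply hXm measurableSet_Iic, Measure.restrict_apply (hXm measurableSet_Iic)]
    have hae := (condDistrib_ae_eq_condExp (μ := μ) (hX (n (Fin.last k))) hXm
      (measurableSet_Iic (a := a))).trans (h k n m a hn hm).symm
    have h1 : ∫ ω in s, (κ (X (n (Fin.last k)) ω)).real (Set.Iic a) ∂μ =
        μ.real ({ω | (X m ω : ℝ) ≤ a} ∩ s) := by
      rw [setIntegral_congr_ae hs' (hae.mono fun _ hx _ => hx), setIntegral_condExp hpast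
        ((integrable_const 1).indicator (hA a)) hs, integral_indicator (hA a)]
      simp [Measure.real, Measure.restrict_apply (hA a)]
    have h2 : ∫⁻ ω in s, κ (X (n (Fin.last k)) ω) (Set.Iic a) ∂μ ≠ ∞ := by
      refine ((lintegral_mono fun ω => prob_le_one).trans_lt ?_).ne
      simp [measure_lt_top]
    have h3 : Measurable (fun ω => κ (X (n (Fin.last k)) ω) (Set.Iic a)) :=
      (Kernel.measurable_coe κ measurableSet_Iic).comp (hX _)
    rw [← ENNReal.toReal_eq_toReal_iff' (measure_ne_top _ _) h2,
      ← integral_toReal h3.aemeasurable (ae_of_all _ fun ω => measure_lt_top _ _)]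
    exact h1.symm
  rw [← lintegral_map hφ hXm, key, Measure.lintegral_bind (Kernel.aemeasurable _) hφ.aemeasurable,
    lintegral_map hφ.lintegral_kernel (hX _)]

lemma comap_le_comap_snoc {ι Ω E : Type*} [MeasurableSpace E] (X : ι → Ω → E) {k : ℕ}
    (n : Fin k → ι) (p : ι) :
    MeasurableSpace.comap (fun ω (j : Fin k) => X (n j) ω) inferInstance ≤
      MeasurableSpace.comap (fun ω (j : Fin (k + 1)) => X (Fin.snoc (α := fun _ => ι) n p j) ω)
        inferInstance := by
  have hr : Measurable (fun (x : Fin (k + 1) → E) (j : Fin k) => x j.castSucc) := by fun_prop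
  rintro _ ⟨B, hB, rfl⟩
  refine ⟨_, hr hB, ?_⟩
  ext ω
  simp

lemma comap_last_le_comap {Ω E : Type*} [MeasurableSpace E] {k : ℕ} (Z : Fin (k + 1) → Ω → E) :
    MeasurableSpace.comap (Z (Fin.last k)) inferInstance ≤
      MeasurableSpace.comap (fun ω (j : Fin (k + 1)) => Z j ω) inferInstance := by
  rintro _ ⟨B, hB, rfl⟩
  exact ⟨_, measurable_pi_apply (Fin.last k) hB, rfl⟩

/-- One-step conditional expectations of the image process given the past of the original
process: they depend on the present image only. -/
lemma IsMarkovProcess.setLIntegral_succ_eq_densityOp {ι Ω : Type*} [LinearOrder ι] [SuccOrder ι]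
    [NoMaxOrder ι] [MeasurableSpace Ω] {S : Set ℝ} {X : ι → Ω → S} {μ : Measure Ω}
    [IsProbabilityMeasure μ] (hX : ∀ n, Measurable (X n)) (hmarkov : IsMarkovProcess X μ)
    {G : ℝ → ℝ} (hG : Measurable G) {f : ℝ → ℝ → ℝ≥0∞} (hf : Measurable (Function.uncurry f))
    (hlaw : ∀ n, μ.map (fun ω => (G (X (Order.succ n) ω), (X n ω : ℝ))) =
      ((volume : Measure ℝ).prod (μ.map fun ω => (X n ω : ℝ))).withDensity
        (fun w => f w.1 (G w.2)))
    {k : ℕ} {n : Fin (k + 1) → ι} (hn : StrictMono n) {s : Set Ω}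
    (hs : MeasurableSet[MeasurableSpace.comap (fun ω (j : Fin (k + 1)) => X (n j) ω)
      inferInstance] s) {φ : ℝ → ℝ≥0∞} (hφ : Measurable φ) :
    ∫⁻ ω in s, φ (G (X (Order.succ (n (Fin.last k))) ω)) ∂μ =
      ∫⁻ ω in s, densityOp f φ (G (X (n (Fin.last k)) ω)) ∂μ := by
  set l := n (Fin.last k)
  have hlt : l < Order.succ l := Order.lt_succ l
  have hXr (i : ι) : Measurable (fun ω => (X i ω : ℝ)) := (hX i).subtype_val
  set κ := condDistrib (fun ω => (X (Order.succ l) ω : ℝ)) (X l) μ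
  have hκm : Measurable (fun x => ∫⁻ z, φ (G z) ∂(κ x)) := (hφ.comp hG).lintegral_kernel
  have hDm : Measurable (fun x : S => densityOp f φ (G x)) :=
    ((measurable_densityOp hf hφ).comp hG).comp measurable_subtype_coe
  have := Measure.isProbabilityMeasure_map (μ := μ) (hX l).aemeasurable
  -- Both functions are versions of the conditional expectation given `X l`.
  have hae : (fun x => ∫⁻ z, φ (G z) ∂(κ x)) =ᵐ[μ.map (X l)]
      fun x => densityOp f φ (G x) := by
    refine ae_eq_of_forall_setLIntegral_eq_of_sigmaFinite hκm hDm fun B hB _ => ?_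
    rw [setLIntegral_map hB hκm (hX l), setLIntegral_map hB hDm (hX l)]
    refine (hmarkov.setLIntegral_eq hX hn hlt
      (comap_last_le_comap (fun j => X (n j)) _ ⟨B, hB, rfl⟩) (hφ.comp hG)).symm.trans ?_
    obtain ⟨B', hB', rfl⟩ := hB
    exact setLIntegral_eq_densityOp (hG.comp (hXr _)) (hXr l) hG hf (hlaw l) hφ hB'
  refine (hmarkov.setLIntegral_eq hX hn hlt hs (hφ.comp hG)).trans ?_
  exact lintegral_congr_ae (ae_restrict_of_ae (ae_of_ae_map (hX l).aemeasurable hae))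

lemma IsMarkovProcess.setLIntegral_iterate_succ_eq_densityOp {ι Ω : Type*} [LinearOrder ι]
    [SuccOrder ι] [NoMaxOrder ι] [MeasurableSpace Ω] {S : Set ℝ} {X : ι → Ω → S} {μ : Measure Ω}
    [IsProbabilityMeasure μ] (hX : ∀ n, Measurable (X n)) (hmarkov : IsMarkovProcess X μ)
    {G : ℝ → ℝ} (hG : Measurable G) {f : ℝ → ℝ → ℝ≥0∞} (hf : Measurable (Function.uncurry f))
    (hlaw : ∀ n, μ.map (fun ω => (G (X (Order.succ n) ω), (X n ω : ℝ))) =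
      ((volume : Measure ℝ).prod (μ.map fun ω => (X n ω : ℝ))).withDensity
        (fun w => f w.1 (G w.2)))
    {φ : ℝ → ℝ≥0∞} (hφ : Measurable φ) (i : ℕ)
    {k : ℕ} {n : Fin (k + 1) → ι} (hn : StrictMono n) {s : Set Ω}
    (hs : MeasurableSet[MeasurableSpace.comap (fun ω (j : Fin (k + 1)) => X (n j) ω)
      inferInstance] s) :
    ∫⁻ ω in s, φ (G (X (Order.succ^[i] (n (Fin.last k))) ω)) ∂μ =
      ∫⁻ ω in s, (densityOp f)^[i] φ (G (X (n (Fin.last k)) ω)) ∂μ := by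
  induction i generalizing k n with
  | zero => rfl
  | succ i ih =>
    have hn' : StrictMono (Fin.snoc (α := fun _ => ι) n (Order.succ (n (Fin.last k)))) := by
      rw [← Fin.insertNth_last']
      exact Fin.strictMono_insertNth_last hn _ (Order.lt_succ _)
    have h1 := ih hn' (comap_le_comap_snoc X n _ _ hs)
    rw [Fin.snoc_last] at h1
    rw [Function.iterate_succ_apply, Function.iterate_succ_apply', h1]
    exact hmarkov.setLIntegral_succ_eq_densityOp hX hG hf hlaw hn hs
      (measurable_densityOp_iterate hf hφ i)

/-! ### Lumpability -/

/-- A nonnegative random variable `ψ` which is measurable with respect to `m` and has the integrals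
of an indicator over all events of `m` represents the conditional probability. -/
lemma toReal_ae_eq_condExp_indicator {Ω : Type*} {m m₀ : MeasurableSpace Ω} {μ : Measure Ω}
    [IsProbabilityMeasure μ] (hm : m ≤ m₀) {A : Set Ω} (hA : MeasurableSet A) {ψ : Ω → ℝ≥0∞}
    (hψ : Measurable[m] ψ)
    (h : ∀ s, MeasurableSet[m] s → ∫⁻ ω in s, A.indicator 1 ω ∂μ = ∫⁻ ω in s, ψ ω ∂μ) :
    (fun ω => (ψ ω).toReal) =ᵐ[μ] μ⟦A | m⟧ := by
  have hψ' : Measurable ψ := hψ.mono hm le_rfl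
  have hfin : ∫⁻ ω, ψ ω ∂μ ≠ ∞ := by
    have h1 := h Set.univ MeasurableSet.univ
    rw [setLIntegral_univ, setLIntegral_univ, lintegral_indicator_one hA] at h1
    rw [← h1]
    exact measure_ne_top _ _
  refine ae_eq_condExp_of_forall_setIntegral_eq hm ((integrable_const 1).indicator hA)
    (fun s _ _ => (integrable_toReal_of_lintegral_ne_top hψ'.aemeasurable hfin).integrableOn)
    (fun s hs _ => ?_) hψ.ennreal_toReal.stronglyMeasurable.aestronglyMeasurable
  rw [integral_toReal hψ'.aemeasurable (ae_restrict_of_ae (ae_lt_top hψ' hfin)), ← h s hs,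
    lintegral_indicator_one hA, integral_indicator hA]
  simp [Measure.real, Measure.restrict_apply hA]

theorem proposition6
    {ι : Type*} [LinearOrder ι] [SuccOrder ι] [NoMaxOrder ι] [IsSuccArchimedean ι]
    {Ω : Type*} [MeasurableSpace Ω] (μ : Measure Ω) [IsProbabilityMeasure μ]
    (𝒳 𝒴 : Set ℝ) (X : ι → Ω → 𝒳) (hXmeas : ∀ n, Measurable (X n))
    (hXstat : IsStationaryProcess X μ) (hXmarkov : IsMarkovProcess X μ)
    (g : 𝒳 → 𝒴) (hg : Measurable g)
    (t : ι)
    (fYX fYgivenX fYgivenY : ℝ → ℝ → ℝ≥0∞)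
    (hfYX : IsJointDensity fYX
      (fun ω => (g (X (Order.succ t) ω) : ℝ)) (fun ω => (X t ω : ℝ)) μ)
    (hfYgivenX : IsCondDensity fYgivenX
      (fun ω => (g (X (Order.succ t) ω) : ℝ)) (fun ω => (X t ω : ℝ)) μ)
    (hfYgivenY : IsCondDensity fYgivenY
      (fun ω => (g (X (Order.succ t) ω) : ℝ)) (fun ω => (g (X t ω) : ℝ)) μ)
    (h : ∀ y₁ y₂ : 𝒴, ∀ x : 𝒳, g x = y₁ →
      0 < fYX y₂ x → fYgivenX y₂ x = fYgivenY y₂ y₁) :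
    IsLumpable X g μ := by
  -- `𝒳` need not be measurable, so `g` is replaced by a Borel map of the whole line.
  obtain ⟨G, hG, hgG'⟩ : ∃ G : ℝ → ℝ, Measurable G ∧
      (fun x : 𝒳 => (g x : ℝ)) = G ∘ Subtype.val :=
    Measurable.exists_eq_measurable_comp (f := (Subtype.val : 𝒳 → ℝ)) hg.subtype_val
  have hgG (x : 𝒳) : (g x : ℝ) = G x := congrFun hgG' x
  have hXr (n : ι) : Measurable (fun ω => (X n ω : ℝ)) := (hXmeas n).subtype_val
  have hV : Measurable (fun ω => G (X (Order.succ t) ω)) := hG.comp (hXr _)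
  simp only [hgG] at hfYX hfYgivenX hfYgivenY
  have hfm := hfYgivenY.1
  have hr : Measurable (fun w : ℝ × ℝ => fYgivenY w.1 (G w.2)) :=
    hfm.comp (measurable_fst.prodMk (hG.comp measurable_snd))
  -- The hypothesis holds at every `(Y₂(ω), X₁(ω))`, and the joint density is a.s. positive there.
  have hpos : ∀ᵐ w ∂μ.map (fun ω => (G (X (Order.succ t) ω), (X t ω : ℝ))),
      0 < Function.uncurry fYX w := by
    rw [hfYX.2, ae_withDensity_iff hfYX.1]
    exact ae_of_all _ fun w hw => pos_iff_ne_zero.2 hw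
  have hagree : ∀ᵐ w ∂μ.map (fun ω => (G (X (Order.succ t) ω), (X t ω : ℝ))),
      fYgivenX w.1 w.2 = fYgivenY w.1 (G w.2) := by
    have hmeas : MeasurableSet {w : ℝ × ℝ | fYgivenX w.1 w.2 = fYgivenY w.1 (G w.2)} :=
      measurableSet_eq_fun hfYgivenX.1 hr
    rw [ae_map_iff (hV.prodMk (hXr t)).aemeasurable hmeas]
    filter_upwards [ae_of_ae_map (hV.prodMk (hXr t)).aemeasurable hpos] with ω hω
    have := h (g (X t ω)) (g (X (Order.succ t) ω)) (X t ω) rfl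
    simp only [hgG] at this
    exact this hω
  have hlawt := map_eq_withDensity_of_ae_eq hV (hXr t) hG hfYgivenX hfYgivenY hagree
  have hlaw (n : ι) : μ.map (fun ω => (G (X (Order.succ n) ω), (X n ω : ℝ))) =
      ((volume : Measure ℝ).prod (μ.map fun ω => (X n ω : ℝ))).withDensity
        (fun w => fYgivenY w.1 (G w.2)) := by
    have hpair := hXstat.map_succ_pair hXmeas n t
    have h1 := congrArg (Measure.map fun p : 𝒳 × 𝒳 => (G p.1, (p.2 : ℝ))) hpair
    have h2 := congrArg (Measure.map fun p : 𝒳 × 𝒳 => (p.2 : ℝ)) hpair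
    have hm (i : ι) : Measurable (fun ω => (X (Order.succ i) ω, X i ω)) :=
      (hXmeas _).prodMk (hXmeas _)
    rw [Measure.map_map (by fun_prop) (hm n), Measure.map_map (by fun_prop) (hm t)] at h1 h2
    simp only [Function.comp_def] at h1 h2
    rw [h1, h2, hlawt]
  intro k n m a hn hm
  have hY (i : ι) : Measurable (fun ω => g (X i ω)) := hg.comp (hXmeas i)
  obtain ⟨i, rfl⟩ := exists_succ_iterate_of_le hm.le
  set l := n (Fin.last k)
  have hA : MeasurableSet {ω | (g (X (Order.succ^[i] l) ω) : ℝ) ≤ a} :=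
    (hY _).subtype_val measurableSet_Iic
  have hφ : Measurable ((Set.Iic a).indicator (1 : ℝ → ℝ≥0∞)) :=
    measurable_one.indicator measurableSet_Iic
  set Ψ := (densityOp fYgivenY)^[i] ((Set.Iic a).indicator 1)
  have hΨ : Measurable Ψ := measurable_densityOp_iterate hfm hφ i
  have hpast : MeasurableSpace.comap (fun ω (j : Fin (k + 1)) => g (X (n j) ω)) inferInstance ≤
      MeasurableSpace.comap (fun ω (j : Fin (k + 1)) => X (n j) ω) inferInstance := by
    have hgg : Measurable (fun (x : Fin (k + 1) → 𝒳) j => g (x j)) := by fun_prop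
    rintro _ ⟨B, hB, rfl⟩
    exact ⟨_, hgg hB, rfl⟩
  have hlast := comap_last_le_comap (fun (j : Fin (k + 1)) ω => g (X (n j) ω))
  have hΨl : Measurable[MeasurableSpace.comap (fun ω => g (X l ω)) inferInstance]
      (fun ω => Ψ (g (X l ω))) :=
    (hΨ.comp measurable_subtype_coe).comp (comap_measurable _)
  have hint (s : Set Ω) (hs : MeasurableSet[MeasurableSpace.comap
      (fun ω (j : Fin (k + 1)) => g (X (n j) ω)) inferInstance] s) :
      ∫⁻ ω in s, {ω | (g (X (Order.succ^[i] l) ω) : ℝ) ≤ a}.indicator 1 ω ∂μ =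
        ∫⁻ ω in s, Ψ (g (X l ω)) ∂μ := by
    simp only [hgG]
    exact hXmarkov.setLIntegral_iterate_succ_eq_densityOp hXmeas hG hfm hlaw hφ i hn (hpast _ hs)
  have hle : MeasurableSpace.comap (fun ω (j : Fin (k + 1)) => g (X (n j) ω)) inferInstance ≤
      ‹MeasurableSpace Ω› := (measurable_pi_lambda _ fun j => hY (n j)).comap_le
  -- Both conditional probabilities are represented by the same function of `Y l`.
  exact (toReal_ae_eq_condExp_indicator hle hA (hΨl.mono hlast le_rfl) hint).symm.trans
    (toReal_ae_eq_condExp_indicator (hlast.trans hle) hA hΨl fun s hs => hint s (hlast s hs))
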